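/- Let $\Sigma$ be a finite alphabet. For $w\in\Sigma^*$ let $\mathsf{Facs}(w)$ be the set of factors (contiguous subwords) of $w$. The logic $\mathsf{FC}$ over $\Sigma$ consists of the first-order formulas, built with $\land,\lor,\neg,\exists,\forall$, from atomic formulas $x \mathbin{\dot=} y\cdot z$, where each of $x,y,z$ is a variable (from a fixed countably infinite set), a constant symbol for a letter $\mathtt a\in\Sigma$, or a constant symbol for the empty word $\varepsilon$. Such a formula is evaluated in a word $w\in\Sigma^*$ as follows: variables take values in, and quantifiers range over, $\mathsf{Facs}(w)$; the constant $\varepsilon$ denotes the empty word; the constant $\mathtt a$ denotes the one-letter word $\mathtt a$ if $\mathtt a$ occurs in $w$, and a null value $\perp\notin\mathsf{Facs}(w)$ otherwise; $x\mathbin{\dot=} y\cdot z$ holds if the values of $x,y,z$ all lie in $\mathsf{Facs}(w)$ and the value of $x$ is the concatenation of the values of $y$ and $z$. A language $L\subseteq\Sigma^*$ is $\mathsf{FC}$-definable if there is an $\mathsf{FC}$-sentence $\varphi$ (a formula without free variables) such that $L$ is the set of all $w\in\Sigma^*$ in which $\varphi$ holds. A nonempty word $w$ is primitive if it is not of the form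 $z^k$ with $z\in\Sigma^*$ and $k>1$. Words $u,v$ are conjugate if $u=xy$ and $v=yx$ for some $x,y\in\Sigma^*$. Two nonempty words are co-primitive if both are primitive and they are not conjugate. Proposition. Let $w_1,w_2,w_3\in\Sigma^*$ and let $u,v\in\Sigma^+$ be co-primitive. Then for every injective function $f\colon\mathbb N\to\mathbb N$ (where $0\in\mathbb N$), the language $$\{\, w_1\cdot u^p\cdot w_2\cdot v^{f(p)}\cdot w_3 \mid p\in\mathbb N \,\}$$ is not $\mathsf{FC}$-definable. -/

import Mathlib

namespace FC

/-! Words over an alphabet `α` are lists over `α`. -/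

/-- The word `w ^ k`, that is, `k` repetitions of `w`. -/
def wpow {α : Type*} (w : List α) (k : ℕ) : List α :=
  (List.replicate k w).flatten

/-- A word is primitive if it is nonempty and not of the form `z ^ k` with `k > 1`. -/
def Primitive {α : Type*} (w : List α) : Prop :=
  w ≠ [] ∧ ¬ ∃ (z : List α) (k : ℕ), 1 < k ∧ w = wpow z k

/-- Two words are conjugate if they are of the form `x y` and `y x`. -/
def Conjugate {α : Type*} (w v : List α) : Prop :=
  ∃ x y : List α, w = x ++ y ∧ v = y ++ x

/-- Two words are co-primitive if both are primitive and they are not conjugate. -/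
def CoPrimitive {α : Type*} (w v : List α) : Prop :=
  Primitive w ∧ Primitive v ∧ ¬ Conjugate w v

/-- `Facs w` is the type of factors (contiguous subwords) of `w`. -/
abbrev Facs {α : Type*} (w : List α) : Type _ := {u : List α // u <:+: w}

/-- The universe of the structure that represents `w`: the factors of `w`, together with an
additional element `none`, playing the role of the null value `⊥`. -/
abbrev Universe {α : Type*} (w : List α) : Type _ := Option (Facs w)

/-- The relation `a = b · c`, restricted to factors of `w`. It never holds if one of the
arguments is the null value. -/
def Concat {α : Type*} {w : List α} (a b c : Universe w) : Prop :=
  ∃ x y z : Facs w, a = some x ∧ b = some y ∧ c = some z ∧ x.1 = y.1 ++ z.1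

theorem singleton_infix_of_mem {α : Type*} {a : α} {w : List α} (h : a ∈ w) : [a] <:+: w := by
  obtain ⟨s, t, rfl⟩ := List.append_of_mem h
  exact ⟨s, t, by simp⟩

open Classical in
/-- The interpretation of the constant symbol for the letter `a` in the structure representing `w`:
the letter `a` if it occurs in `w`, and the null value otherwise. -/
noncomputable def letterConst {α : Type*} (w : List α) (a : α) : Universe w :=
  if h : a ∈ w then some ⟨[a], singleton_infix_of_mem h⟩ else none

/-- The interpretation of the constant symbol for the empty word. -/
def epsConst {α : Type*} (w : List α) : Universe w :=
  some ⟨[], List.nil_infix⟩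

/-- Terms of the logic FC over the alphabet `α`: variables (indexed by natural numbers), letters,
and the empty word. -/
inductive Term (α : Type*) where
  | var (x : ℕ) : Term α
  | letter (a : α) : Term α
  | eps : Term α

/-- Formulas of the logic FC over the alphabet `α`; `Formula.eqConcat x y z` is the atomic
formula `x ≐ y · z`. -/
inductive Formula (α : Type*) where
  | eqConcat (x y z : Term α) : Formula α
  | and (φ ψ : Formula α) : Formula α
  | or (φ ψ : Formula α) : Formula α
  | not (φ : Formula α) : Formula α
  | all (x : ℕ) (φ : Formula α) : Formula α
  | ex (x : ℕ) (φ : Formula α) : Formula α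

/-- The variables that occur in a term. -/
def Term.vars {α : Type*} : Term α → Set ℕ
  | .var x => {x}
  | .letter _ => ∅
  | .eps => ∅

/-- The free variables of a formula. -/
def Formula.freeVars {α : Type*} : Formula α → Set ℕ
  | .eqConcat x y z => x.vars ∪ y.vars ∪ z.vars
  | .and φ ψ => φ.freeVars ∪ ψ.freeVars
  | .or φ ψ => φ.freeVars ∪ ψ.freeVars
  | .not φ => φ.freeVars
  | .all x φ => φ.freeVars \ {x}
  | .ex x φ => φ.freeVars \ {x}

/-- A sentence is a formula without free variables. -/
def Formula.IsSentence {α : Type*} (φ : Formula α) : Prop :=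
  φ.freeVars = ∅

/-- The value of a term in the structure representing `w`. Variables are interpreted by factors
of `w`, never by the null value. -/
noncomputable def Term.eval {α : Type*} {w : List α} (σ : ℕ → Facs w) : Term α → Universe w
  | .var x => some (σ x)
  | .letter a => letterConst w a
  | .eps => epsConst w

/-- Satisfaction of a formula in the structure representing `w`, under the assignment `σ`.
Quantifiers range over the factors of `w`. -/
def Formula.Sat {α : Type*} {w : List α} : (ℕ → Facs w) → Formula α → Prop
  | σ, .eqConcat x y z => Concat (x.eval σ) (y.eval σ) (z.eval σ)
  | σ, .and φ ψ => φ.Sat σ ∧ ψ.Sat σ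
  | σ, .or φ ψ => φ.Sat σ ∨ ψ.Sat σ
  | σ, .not φ => ¬ φ.Sat σ
  | σ, .all x φ => ∀ u : Facs w, φ.Sat (Function.update σ x u)
  | σ, .ex x φ => ∃ u : Facs w, φ.Sat (Function.update σ x u)

/-- Evaluation of a term depends only on the values of its variables. -/
theorem Term.eval_congr {α : Type*} {w : List α} {σ τ : ℕ → Facs w} (t : Term α)
    (h : ∀ x ∈ t.vars, σ x = τ x) : t.eval σ = t.eval τ := by
  cases t <;> simp_all [Term.eval, Term.vars]

/-- Satisfaction depends only on the values of the free variables; in particular, satisfaction of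
a sentence does not depend on the assignment. -/
theorem Formula.sat_congr {α : Type*} {w : List α} (φ : Formula α) :
    ∀ {σ τ : ℕ → Facs w}, (∀ x ∈ φ.freeVars, σ x = τ x) → (φ.Sat σ ↔ φ.Sat τ) := by
  induction φ with
  | eqConcat x y z =>
    intro σ τ h
    simp only [Formula.freeVars, Set.mem_union] at h
    rw [Formula.Sat, Formula.Sat, x.eval_congr (fun i hi => h i (.inl (.inl hi))),
      y.eval_congr (fun i hi => h i (.inl (.inr hi))), z.eval_congr (fun i hi => h i (.inr hi))]
  | and φ ψ ihφ ihψ =>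
    intro σ τ h
    exact and_congr (ihφ fun i hi => h i (.inl hi)) (ihψ fun i hi => h i (.inr hi))
  | or φ ψ ihφ ihψ =>
    intro σ τ h
    exact or_congr (ihφ fun i hi => h i (.inl hi)) (ihψ fun i hi => h i (.inr hi))
  | not φ ih =>
    intro σ τ h
    exact not_congr (ih h)
  | all x φ ih =>
    intro σ τ h
    refine forall_congr' fun u => ih fun i hi => ?_
    by_cases hx : i = x
    · subst hx; simp
    · simpa [hx] using h i ⟨hi, hx⟩
  | ex x φ ih =>
    intro σ τ h
    refine exists_congr fun u => ih fun i hi => ?_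
    by_cases hx : i = x
    · subst hx; simp
    · simpa [hx] using h i ⟨hi, hx⟩

/-- The language of a formula: the words `w` whose structure satisfies it under every assignment.
This is used for sentences only, where the assignment does not matter. -/
def Formula.lang {α : Type*} (φ : Formula α) : Set (List α) :=
  {w | ∀ σ : ℕ → Facs w, φ.Sat σ}

/-- A language is FC-definable if it is the language of some sentence of FC. -/
def Definable {α : Type*} (L : Set (List α)) : Prop :=
  ∃ φ : Formula α, φ.IsSentence ∧ φ.lang = L

end FC

/-!
The proof shows that no sentence can relate the exponent of `u` to that of `v`: for every sentence
there are exponents `p ≠ q` such that `w₁ u ^ p w₂ v ^ m w₃` can be replaced by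
`w₁ u ^ q w₂ v ^ m w₃` without losing satisfaction, whatever `m` is
(`Formula.IsSentence.exists_exchange`). For `m = f p` the second word would have to be
`w₁ u ^ r w₂ v ^ (f r) w₃` for some `r`; since `u` and `v` are co-primitive, both exponents are
determined by the word (`CoPrimitive.wpow_append_inj`), so `r = q` and `f p = f q`, against the
injectivity of `f`.

The exchange rests on an Ehrenfeucht-Fraïssé game on numbers. Put `A = w₁` and `B = w₂ v ^ m w₃`.
Every factor of `A u ^ p B` has the form `s u ^ i t` with `i ≤ p` and outer words `s`, `t` cut out
of `A`, `u` and `B` (`exists_isTemplate`). A move on factors is answered by keeping the outer words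
and changing only the exponent, according to a winning strategy in the game on the segments
`[0, p]` and `[0, q]` in which the equations `x + d = y + z` and `x = y + z + d` with bounded `d`
have to be preserved (`GameEquiv`). The equivalences given by this game have finite index, so that
suitable `p ≠ q` exist by the pigeonhole principle.

That this strategy preserves concatenation is `AtomEquiv.concat_run`. The outer words contain only
bounded powers of `u`; for `B` this is where co-primitivity enters, and the bound does not depend
on `m` (`CoPrimitive.exists_powFree`). As `u` is primitive, long runs of `u` in the same word are
aligned modulo `|u|` (`Primitive.align_left`), so an equation between words `s u ^ i t` amounts to
equations between outer words and a linear relation with bounded constant between exponents.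
-/

namespace FC

/-! ### Powers of words -/

section Words

variable {α : Type*}

theorem prefix_append_cases {x a b : List α} (h : x <+: a ++ b) :
    x <+: a ∨ ∃ y, x = a ++ y ∧ y <+: b := by
  rcases List.prefix_or_prefix_of_prefix h (List.prefix_append a b) with h' | ⟨y, rfl⟩
  · exact .inl h'
  · exact .inr ⟨y, rfl, (List.prefix_append_right_inj a).1 h⟩

theorem suffix_append_cases {x a b : List α} (h : x <:+ a ++ b) :
    x <:+ b ∨ ∃ y, x = y ++ b ∧ y <:+ a := by
  rcases List.suffix_or_suffix_of_suffix h (List.suffix_append a b) with h' | ⟨y, rfl⟩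
  · exact .inl h'
  · exact .inr ⟨y, rfl, by
      obtain ⟨t, ht⟩ := h
      exact ⟨t, List.append_cancel_right (by simpa using ht)⟩⟩

@[simp] theorem wpow_zero (u : List α) : wpow u 0 = [] := rfl

theorem wpow_succ (u : List α) (n : ℕ) : wpow u (n + 1) = u ++ wpow u n := by
  simp [wpow, List.replicate_succ]

@[simp] theorem wpow_one (u : List α) : wpow u 1 = u := by simp [wpow]

theorem wpow_add (u : List α) (m n : ℕ) : wpow u (m + n) = wpow u m ++ wpow u n := by
  rw [wpow, List.replicate_add, List.flatten_append, wpow, wpow]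

@[simp] theorem length_wpow (u : List α) (n : ℕ) : (wpow u n).length = n * u.length := by
  simp [wpow]

@[simp] theorem reverse_wpow (u : List α) (n : ℕ) : (wpow u n).reverse = wpow u.reverse n := by
  simp [wpow, List.reverse_flatten]

theorem wpow_append_append (r s : List α) (n : ℕ) :
    wpow (r ++ s) n ++ r = r ++ wpow (s ++ r) n := by
  induction n with
  | zero => simp
  | succ n ih => simp [wpow_succ, ih]

theorem wpow_prefix_of_le {u : List α} {m n : ℕ} (h : m ≤ n) : wpow u m <+: wpow u n := by
  obtain ⟨k, rfl⟩ := Nat.exists_eq_add_of_le h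
  rw [wpow_add]
  exact List.prefix_append _ _

theorem prefix_wpow {u z : List α} (hu : u ≠ []) {n : ℕ} (h : z <+: wpow u n) :
    ∃ a r, z = wpow u a ++ r ∧ r <+: u ∧ (a < n ∧ r.length < u.length ∨ a = n ∧ r = []) := by
  have hu' := List.length_pos_iff.2 hu
  induction n generalizing z with
  | zero => exact ⟨0, [], by simpa using h, by simp, by simp⟩
  | succ n ih =>
    rw [wpow_succ] at h
    rcases prefix_append_cases h with h | ⟨y, rfl, h'⟩
    · rcases h.length_le.lt_or_eq with hl | hl
      · exact ⟨0, z, by simp, h, .inl ⟨by omega, hl⟩⟩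
      · obtain rfl := h.eq_of_length hl
        refine ⟨1, [], by simp, by simp, ?_⟩
        rcases Nat.eq_zero_or_pos n with rfl | hn
        · exact .inr ⟨rfl, rfl⟩
        · exact .inl ⟨by omega, hu'⟩
    · obtain ⟨a, r, rfl, hr, ha⟩ := ih h'
      exact ⟨a + 1, r, by simp [wpow_succ], hr, by simpa using ha⟩

theorem suffix_wpow {u z : List α} (hu : u ≠ []) {n : ℕ} (h : z <:+ wpow u n) :
    ∃ a r, z = r ++ wpow u a ∧ r <:+ u ∧ (a < n ∧ r.length < u.length ∨ a = n ∧ r = []) := by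
  rw [← List.reverse_prefix, reverse_wpow] at h
  obtain ⟨a, r, hz, hr, ha⟩ := prefix_wpow (by simpa using hu) h
  refine ⟨a, r.reverse, ?_, ?_, by simpa using ha⟩
  · simpa using congrArg List.reverse hz
  · simpa using List.reverse_suffix.2 hr

/-! ### Commutation and primitivity -/

/-- Commuting words are powers of a common word. -/
theorem exists_wpow_of_append_comm {x y : List α} (h : x ++ y = y ++ x) :
    ∃ z k l, x = wpow z k ∧ y = wpow z l := by
  induction hn : x.length + y.length using Nat.strong_induction_on generalizing x y with
  | _ n ih =>
    subst hn
    -- Euclid's algorithm on the lengths: strip the shorter word from the longer one.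
    wlog hxy : x.length ≤ y.length generalizing x y
    · obtain ⟨z, k, l, hy, hx⟩ := this h.symm (fun m hm => ih m (by omega)) (by omega)
      exact ⟨z, l, k, hx, hy⟩
    rcases x.eq_nil_or_concat with rfl | hx
    · exact ⟨y, 0, 1, by simp, by simp⟩
    have hx : 0 < x.length := by obtain ⟨_, _, rfl⟩ := hx; simp
    obtain ⟨y', rfl⟩ := List.prefix_of_prefix_length_le ⟨y, h⟩ (List.prefix_append y x) hxy
    rw [List.append_assoc, List.append_cancel_left_eq] at h
    obtain ⟨z, k, l, hx, hy⟩ := ih _ (by simp; omega) h rfl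
    exact ⟨z, k, k + l, hx, by rw [wpow_add, ← hx, ← hy]⟩

/-- A primitive word occurs in its own square only as a prefix and as a suffix. -/
theorem Primitive.eq_nil_of_append_prefix {u r : List α} (hu : Primitive u)
    (h : r ++ u <+: u ++ u) (hr : r.length < u.length) : r = [] := by
  obtain ⟨r', rfl⟩ : r <+: u :=
    List.prefix_of_prefix_length_le ((List.prefix_append _ _).trans h) (List.prefix_append _ _)
      hr.le
  have hc : r ++ r' = r' ++ r := by
    rw [List.append_assoc, List.prefix_append_right_inj] at h
    refine (List.prefix_of_prefix_length_le h (l₂ := r' ++ r) ⟨r', by simp⟩ ?_).eq_of_length ?_ <;>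
    simp <;> omega
  obtain ⟨z, k, l, rfl, rfl⟩ := exists_wpow_of_append_comm hc
  rcases k with _ | k
  · rfl
  rcases l with _ | l
  · simp at hr
  · exact absurd ⟨z, k + 1 + (l + 1), by omega, (wpow_add ..).symm⟩ hu.2

theorem Primitive.reverse {u : List α} (hu : Primitive u) : Primitive u.reverse := by
  refine ⟨by simpa using hu.1, ?_⟩
  rintro ⟨z, k, hk, h⟩
  exact hu.2 ⟨z.reverse, k, hk, by simpa using congrArg List.reverse h⟩

/-- Conjugates of powers are powers. -/
theorem exists_wpow_of_append_eq_wpow {x y z : List α} {k : ℕ} (h : x ++ y = wpow z k) :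
    ∃ z', y ++ x = wpow z' k := by
  rcases eq_or_ne z [] with rfl | hz
  · refine ⟨[], ?_⟩
    have hl : ((x ++ y).length) = 0 := by rw [h]; simp
    have hx : x = [] := List.length_eq_zero_iff.1 (by simp at hl; simp [hl])
    have hy : y = [] := List.length_eq_zero_iff.1 (by simp at hl; simp [hl])
    subst hx hy
    exact h
  obtain ⟨a, r, rfl, ⟨r', rfl⟩, ha⟩ := prefix_wpow hz (n := k) ⟨y, h⟩
  refine ⟨r' ++ r, ?_⟩
  have hk : a + (k - a) = k := by omega
  have hy : r ++ y = wpow (r ++ r') (k - a) := by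
    rw [← hk, wpow_add, List.append_assoc, List.append_cancel_left_eq] at h
    exact h
  apply List.append_cancel_left (as := r)
  rw [← wpow_append_append, ← hk, Nat.add_comm, wpow_add, ← hy]
  simp

/-- If a power of a primitive word `u` is also a power of `y`, then `y` is a power of `u`. -/
theorem exists_wpow_of_wpow_eq {u y : List α} (hu : Primitive u) {b c : ℕ} (hb : 0 < b)
    (hc : 0 < c) (h : wpow u b = wpow y c) : ∃ l, y = wpow u l := by
  obtain ⟨b, rfl⟩ := Nat.exists_eq_add_of_le' hb
  obtain ⟨c, rfl⟩ := Nat.exists_eq_add_of_le' hc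
  -- Both `u y` and `y u` are prefixes of the square of the common power.
  have h1 : u ++ y <+: wpow u (b + 1) ++ wpow u (b + 1) := by
    have : wpow u (b + 1) ++ wpow u (b + 1) = (u ++ y) ++ (wpow y c ++ wpow u b) := by
      rw [← wpow_add, show b + 1 + (b + 1) = 1 + (b + 1) + b by omega, wpow_add, wpow_add, h,
        wpow_succ y]
      simp
    exact ⟨_, this.symm⟩
  have h2 : y ++ u <+: wpow u (b + 1) ++ wpow u (b + 1) := by
    have : wpow u (b + 1) ++ wpow u (b + 1) = (y ++ u) ++ (wpow u b ++ wpow y c) := by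
      rw [h, ← wpow_add, show c + 1 + (c + 1) = 1 + (c + 1) + c by omega, wpow_add, wpow_add, ← h,
        wpow_succ u]
      simp
    exact ⟨_, this.symm⟩
  obtain ⟨z, k, l, rfl, rfl⟩ := exists_wpow_of_append_comm
    ((List.prefix_of_prefix_length_le h1 h2 (by simp [Nat.add_comm])).eq_of_length
      (by simp [Nat.add_comm]))
  have hk : k = 1 := by
    rcases k with _ | _ | k
    · exact absurd rfl hu.1
    · rfl
    · exact absurd ⟨z, k + 2, by omega, rfl⟩ hu.2
  exact ⟨l, by simp [hk]⟩

/-- A long power of `u` occurs in a power of `v` only if `u` and `v` are not co-primitive. -/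
theorem CoPrimitive.not_wpow_infix {u v : List α} (h : CoPrimitive u v) (m : ℕ) :
    ¬ wpow u v.length <:+: wpow v m := by
  obtain ⟨hu, hv, huv⟩ := h
  rintro ⟨L, R, h⟩
  have hu' := List.length_pos_iff.2 hu.1
  have hv' := List.length_pos_iff.2 hv.1
  rw [List.append_assoc] at h
  obtain ⟨a, r, rfl, ⟨r', rfl⟩, ha⟩ := prefix_wpow hv.1 (n := m) ⟨_, h⟩
  have hl : (wpow u (r ++ r').length).length ≤ (m - a) * (r ++ r').length := by
    have := congrArg List.length h
    simp only [List.length_append, length_wpow] at this ⊢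
    rw [Nat.sub_mul]
    omega
  have hm : a + (m - a) = m := by omega
  -- The occurrence starts inside `v = r r'`, so it is a prefix of a power of the conjugate `r' r`.
  have hp : wpow u (r ++ r').length <+: wpow (r' ++ r) (m - a) := by
    rw [← hm, wpow_add, List.append_assoc, List.append_cancel_left_eq] at h
    refine ⟨R ++ r, List.append_cancel_left (as := r) ?_⟩
    rw [← wpow_append_append, ← h]
    simp
  have hle : u.length ≤ m - a := by
    rw [length_wpow, Nat.mul_comm] at hl
    exact Nat.le_of_mul_le_mul_right hl hv'
  have he : wpow u (r ++ r').length = wpow (r' ++ r) u.length :=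
    (List.prefix_of_prefix_length_le hp (wpow_prefix_of_le hle)
      (by simp; rw [Nat.mul_comm, Nat.add_comm])).eq_of_length
      (by simp; rw [Nat.mul_comm, Nat.add_comm])
  obtain ⟨l, hl⟩ := exists_wpow_of_wpow_eq hu hv' hu' he
  obtain ⟨z, hz⟩ := exists_wpow_of_append_eq_wpow hl
  rcases l with _ | _ | l
  · simp at hl
    simp [hl] at hv'
  · exact huv ⟨r', r, by simpa using hl.symm, rfl⟩
  · exact hv.2 ⟨z, l + 2, by omega, hz⟩

/-! ### Words without high powers of `u` -/

/-- `u ^ N` does not occur in `x`. -/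
def PowFree (u : List α) (N : ℕ) (x : List α) : Prop := ¬ wpow u N <:+: x

theorem PowFree.of_infix {u x y : List α} {N : ℕ} (hy : PowFree u N y) (h : x <:+: y) :
    PowFree u N x := fun h' => hy (h'.trans h)

theorem PowFree.mono {u x : List α} {M N : ℕ} (hx : PowFree u M x) (h : M ≤ N) :
    PowFree u N x := fun h' => hx ((wpow_prefix_of_le h).isInfix.trans h')

theorem powFree_of_length_lt {u x : List α} {N : ℕ} (h : x.length < N * u.length) :
    PowFree u N x := fun h' => by
  have := h'.length_le
  rw [length_wpow] at this
  omega

theorem powFree_wpow {u : List α} (hu : u ≠ []) (n : ℕ) : PowFree u (n + 1) (wpow u n) := by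
  have := List.length_pos_iff.2 hu
  exact powFree_of_length_lt (by simp [Nat.add_mul, this])

theorem powFree_length_succ {u : List α} (hu : u ≠ []) (x : List α) :
    PowFree u (x.length + 1) x := by
  have := List.length_pos_iff.2 hu
  exact powFree_of_length_lt (by nlinarith)

theorem PowFree.append {u x y : List α} {M N : ℕ} (hx : PowFree u M x) (hy : PowFree u N y) :
    PowFree u (M + N) (x ++ y) := by
  intro h
  rw [wpow_add] at h
  rcases List.infix_append_iff.1 h with h | h | ⟨l₁, l₂, h, h₁, h₂⟩
  · exact hx (List.infix_append_left.trans h)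
  · exact hy (List.infix_append_right.trans h)
  · rcases List.append_eq_append_iff.1 h with ⟨c, rfl, -⟩ | ⟨c, -, rfl⟩
    · exact hx (List.infix_append_left.trans h₁.isInfix)
    · exact hy (List.infix_append_right.trans h₂.isInfix)

theorem PowFree.reverse {u x : List α} {N : ℕ} (hx : PowFree u N x) :
    PowFree u.reverse N x.reverse := by
  rw [PowFree, ← reverse_wpow, List.reverse_infix]
  exact hx

/-- For co-primitive `u`, `v`, the powers of `u` in the words `x v ^ m y` are bounded uniformly
in `m`. -/
theorem CoPrimitive.exists_powFree {u v : List α} (h : CoPrimitive u v) (x y : List α) :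
    ∃ N, ∀ m, PowFree u N (x ++ wpow v m ++ y) :=
  ⟨_, fun m => ((powFree_length_succ h.1.1 x).append (h.not_wpow_infix m)).append
    (powFree_length_succ h.1.1 y)⟩

end Words

/-! ### Alignment of long runs -/

section Runs

variable {α : Type*}

/-- Two long runs of a primitive word `u` in the same word, each preceded by a word without high
powers of `u`, are aligned: the positions at which they start differ by a bounded multiple
of `|u|`. -/
theorem Primitive.align_left {u : List α} (hu : Primitive u) {N i j : ℕ} {s s' R R' : List α}
    (hs : PowFree u N s) (hs' : PowFree u N s') (hi : N + 2 ≤ i) (hj : N + 2 ≤ j)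
    (h : s ++ (wpow u i ++ R) = s' ++ (wpow u j ++ R')) :
    ∃ a a', a ≤ N ∧ a' ≤ N ∧ s ++ wpow u a = s' ++ wpow u a' := by
  wlog hle : s.length ≤ s'.length generalizing s s' i j R R'
  · obtain ⟨a, a', ha, ha', he⟩ := this hs' hs hj hi h.symm (by omega)
    exact ⟨a', a, ha', ha, he.symm⟩
  obtain ⟨z, rfl⟩ : s <+: s' :=
    List.prefix_of_prefix_length_le ⟨_, h⟩ (List.prefix_append _ _) hle
  rw [List.append_assoc, List.append_cancel_left_eq] at h
  have hz : z <+: wpow u N := by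
    have h1 : wpow u N <+: wpow u i ++ R :=
      (wpow_prefix_of_le (by omega)).trans (List.prefix_append _ _)
    have h2 : z <+: wpow u i ++ R := ⟨_, h.symm⟩
    rcases List.prefix_or_prefix_of_prefix h1 h2 with h3 | h3
    · exact absurd (h3.isInfix.trans List.infix_append_right) hs'
    · exact h3
  obtain ⟨a, r, rfl, hr, ha⟩ := prefix_wpow hu.1 hz
  have hr' : r.length < u.length := by
    rcases ha with ha | ⟨-, rfl⟩
    · exact ha.2
    · exact List.length_pos_iff.2 hu.1
  have haN : a ≤ N := by omega
  obtain ⟨i, rfl⟩ : ∃ i', i = a + (1 + (1 + i')) := ⟨i - a - 2, by omega⟩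
  obtain ⟨j, rfl⟩ : ∃ j', j = 1 + j' := ⟨j - 1, by omega⟩
  simp only [wpow_add, List.append_assoc, List.append_cancel_left_eq, wpow_one] at h
  have hr0 : r = [] := hu.eq_nil_of_append_prefix
    (List.prefix_of_prefix_length_le (l₃ := u ++ (u ++ (wpow u i ++ R)))
      ⟨wpow u j ++ R', by simp [h]⟩ ⟨wpow u i ++ R, by simp⟩ (by simp; omega)) hr'
  exact ⟨a, 0, haN, by omega, by simp [hr0]⟩

theorem Primitive.align_right {u : List α} (hu : Primitive u) {N i j : ℕ} {t t' L L' : List α}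
    (ht : PowFree u N t) (ht' : PowFree u N t') (hi : N + 2 ≤ i) (hj : N + 2 ≤ j)
    (h : L ++ (wpow u i ++ t) = L' ++ (wpow u j ++ t')) :
    ∃ b b', b ≤ N ∧ b' ≤ N ∧ wpow u b ++ t = wpow u b' ++ t' := by
  obtain ⟨b, b', hb, hb', he⟩ := hu.reverse.align_left ht.reverse ht'.reverse hi hj
    (R := L.reverse) (R' := L'.reverse) (by simpa using congrArg List.reverse h)
  exact ⟨b, b', hb, hb', by simpa using congrArg List.reverse he⟩

/-- An equation between two words with one long run each determines the difference of the two
exponents, and holds for all long runs whose exponents have this difference. -/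
theorem Primitive.run_eq_run {u : List α} (hu : Primitive u) {N i j : ℕ} {s t s' t' : List α}
    (hs : PowFree u N s) (ht : PowFree u N t) (hs' : PowFree u N s') (ht' : PowFree u N t')
    (hi : 2 * N + 2 ≤ i) (hj : N + 2 ≤ j)
    (h : s ++ (wpow u i ++ t) = s' ++ (wpow u j ++ t')) :
    ∃ X Y, X ≤ 2 * N ∧ Y ≤ 2 * N ∧ i + X = j + Y ∧
      ∀ i' j', 2 * N ≤ i' → i' + X = j' + Y →
        s ++ (wpow u i' ++ t) = s' ++ (wpow u j' ++ t') := by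
  obtain ⟨a, a', ha, ha', hA⟩ := hu.align_left hs hs' (by omega) hj h
  obtain ⟨b, b', hb, hb', hB⟩ := hu.align_right ht ht' (by omega) hj h
  have hpos := List.length_pos_iff.2 hu.1
  refine ⟨a' + b', a + b, by omega, by omega, ?_, ?_⟩
  · have h1 := congrArg List.length h
    have h2 := congrArg List.length hA
    have h3 := congrArg List.length hB
    simp only [List.length_append, length_wpow] at h1 h2 h3
    apply Nat.eq_of_mul_eq_mul_right hpos
    simp only [Nat.add_mul]
    omega
  · intro i' j' hi' he
    obtain ⟨k, rfl⟩ : ∃ k, i' = a + k + b := ⟨i' - a - b, by omega⟩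
    obtain rfl : j' = a' + k + b' := by omega
    simp only [wpow_add, List.append_assoc, hB]
    rw [← List.append_assoc, hA, List.append_assoc]

/-- An equation between a word with one long run and a word with two long runs determines the
difference of the exponent on the left and the sum of the exponents on the right, and holds for all
long runs whose exponents have this difference. -/
theorem Primitive.run_eq_run_append_run {u : List α} (hu : Primitive u) {N i j k : ℕ}
    {s t s' m t' : List α}
    (hs : PowFree u N s) (ht : PowFree u N t) (hs' : PowFree u N s') (hm : PowFree u N m)
    (ht' : PowFree u N t') (hi : 2 * N + 2 ≤ i) (hj : N + 2 ≤ j) (hk : N + 2 ≤ k)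
    (h : s ++ (wpow u i ++ t) = s' ++ (wpow u j ++ (m ++ (wpow u k ++ t')))) :
    ∃ X Y, X ≤ 3 * N ∧ Y ≤ 3 * N ∧ i + X = j + k + Y ∧
      ∀ i' j' k', 2 * N ≤ i' → i' + X = j' + k' + Y →
        s ++ (wpow u i' ++ t) = s' ++ (wpow u j' ++ (m ++ (wpow u k' ++ t'))) := by
  obtain ⟨a, a', ha, ha', hA⟩ := hu.align_left hs hs' (by omega) hj h
  obtain ⟨b, b', hb, hb', hB⟩ := hu.align_right (i := i) (L := s)
    (L' := s' ++ (wpow u j ++ m)) ht ht' (by omega) hk (by simpa using h)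
  have hpos := List.length_pos_iff.2 hu.1
  have key : ∀ n, s ++ (wpow u (a + n + b) ++ t) = s' ++ (wpow u (a' + n + b') ++ t') := by
    intro n
    simp only [wpow_add, List.append_assoc, hB]
    rw [← List.append_assoc, hA, List.append_assoc]
  -- Cancelling the outer words shows that the word between the two runs is a power of `u`.
  obtain ⟨n, rfl⟩ : ∃ n, i = a + n + b := ⟨i - a - b, by omega⟩
  rw [key, List.append_cancel_left_eq] at h
  have h' : wpow u (a' + n + b') = wpow u j ++ (m ++ wpow u k) :=
    List.append_cancel_right (bs := t') (by simpa using h)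
  have hle : j + k ≤ a' + n + b' := by
    have := congrArg List.length h'
    simp only [List.length_append, length_wpow] at this
    refine Nat.le_of_mul_le_mul_right ?_ hpos
    rw [Nat.add_mul]
    omega
  obtain ⟨c, hc⟩ : ∃ c, a' + n + b' = j + (c + k) := ⟨a' + n + b' - j - k, by omega⟩
  rw [hc, wpow_add, wpow_add, List.append_cancel_left_eq] at h'
  obtain rfl := List.append_cancel_right h'
  have hcN : c ≤ N := by
    by_contra hlt
    exact hm (wpow_prefix_of_le (by omega)).isInfix
  refine ⟨a' + b', a + b + c, by omega, by omega, by omega, ?_⟩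
  intro i' j' k' hi' he
  obtain ⟨n', rfl⟩ : ∃ n', i' = a + n' + b := ⟨i' - a - b, by omega⟩
  rw [key, show a' + n' + b' = j' + (c + k') by omega]
  simp only [wpow_add, List.append_assoc]

end Runs

/-! ### Bounded linear equivalence of exponents -/

/-- The sequences `g` and `h` satisfy the same equations `x = y + z + d` and `x + d = y + z` with
`d ≤ D` among their first `n` entries. -/
def AtomEquiv (n D : ℕ) (g h : ℕ → ℕ) : Prop :=
  ∀ a < n, ∀ b < n, ∀ c < n, ∀ d ≤ D,
    (g a = g b + g c + d ↔ h a = h b + h c + d) ∧ (g a + d = g b + g c ↔ h a + d = h b + h c)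

namespace AtomEquiv

variable {n D : ℕ} {g h : ℕ → ℕ}

theorem symm (H : AtomEquiv n D g h) : AtomEquiv n D h g :=
  fun a ha b hb c hc d hd => ⟨(H a ha b hb c hc d hd).1.symm, (H a ha b hb c hc d hd).2.symm⟩

theorem linear (H : AtomEquiv n D g h) {a b c X Y : ℕ} (ha : a < n) (hb : b < n) (hc : c < n)
    (hX : X ≤ D) (hY : Y ≤ D) (e : g a + X = g b + g c + Y) : h a + X = h b + h c + Y := by
  rcases Nat.le_total X Y with hXY | hXY
  · have := (H a ha b hb c hc (Y - X) (by omega)).1.1 (by omega)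
    omega
  · have := (H a ha b hb c hc (X - Y) (by omega)).2.1 (by omega)
    omega

theorem eq_add (H : AtomEquiv n D g h) (g0 : g 0 = 0) (h0 : h 0 = 0) {a b X Y : ℕ}
    (ha : a < n) (hb : b < n) (hX : X ≤ D) (hY : Y ≤ D)
    (e : g a + X = g b + Y) : h a + X = h b + Y := by
  simpa [h0] using H.linear ha hb (c := 0) (by omega) hX hY (by omega)

theorem eq_of_le (H : AtomEquiv n D g h) (g0 : g 0 = 0) (h0 : h 0 = 0) {a : ℕ}
    (ha : a < n) (hD : g a ≤ D) : h a = g a := by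
  simpa [h0] using H.eq_add g0 h0 ha (b := 0) (X := 0) (by omega) (by omega) hD (by omega)

theorem le_of_le (H : AtomEquiv n D g h) (g0 : g 0 = 0) (h0 : h 0 = 0) {a K : ℕ}
    (ha : a < n) (hK : K ≤ D) (hg : K ≤ g a) : K ≤ h a := by
  by_contra hlt
  have := H.symm.eq_of_le h0 g0 ha (by omega)
  omega

/-- An equation `x = y z` between words of the form `s u ^ e t`, with `s` and `t` free of high
powers of the primitive word `u`, depends only on the bounded linear relations between the three
exponents. -/
theorem concat_run (H : AtomEquiv n D g h) (g0 : g 0 = 0) (h0 : h 0 = 0) {α : Type*} {u : List α}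
    (hu : Primitive u) {N : ℕ} (hD : 50 * (N + 1) ≤ D) {a b c : ℕ} (ha : a < n) (hb : b < n)
    (hc : c < n) {s t s₁ t₁ s₂ t₂ : List α} (hs : PowFree u N s) (ht : PowFree u N t)
    (hs₁ : PowFree u N s₁) (ht₁ : PowFree u N t₁) (hs₂ : PowFree u N s₂) (ht₂ : PowFree u N t₂)
    (e : s ++ (wpow u (g a) ++ t) = s₁ ++ (wpow u (g b) ++ (t₁ ++ (s₂ ++ (wpow u (g c) ++ t₂))))) :
    s ++ (wpow u (h a) ++ t) = s₁ ++ (wpow u (h b) ++ (t₁ ++ (s₂ ++ (wpow u (h c) ++ t₂)))) := by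
  have hfree : PowFree u (N + (g a + 1 + N)) (s ++ (wpow u (g a) ++ t)) :=
    hs.append ((powFree_wpow hu.1 _).append ht)
  have hbfree : g b < N + (g a + 1 + N) := by
    by_contra hlt
    refine hfree ?_
    rw [e]
    exact (wpow_prefix_of_le (by omega)).isInfix.trans (List.infix_append' ..)
  have hcfree : g c < N + (g a + 1 + N) := by
    by_contra hlt
    refine hfree ?_
    rw [e]
    refine (wpow_prefix_of_le (n := g c) (by omega)).isInfix.trans
      ⟨s₁ ++ (wpow u (g b) ++ (t₁ ++ s₂)), t₂, by simp⟩
  -- The threshold for the left-hand run is generous: the cases below need `11 * N + O(1)`.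
  rcases Nat.lt_or_ge (g a) (20 * (N + 1)) with hlt | hge
  · -- All exponents are small, hence determined.
    rw [H.eq_of_le g0 h0 ha (by omega), H.eq_of_le g0 h0 hb (by omega),
      H.eq_of_le g0 h0 hc (by omega), e]
  have hge' : 20 * (N + 1) ≤ h a := H.le_of_le g0 h0 ha (by omega) hge
  -- A short run on the right is absorbed into the surrounding word, which is then free of
  -- powers of `u` with exponent `M`. The other run is long because the run on the left is.
  set M := 5 * (N + 1)
  rcases Nat.lt_or_ge (g b) (2 * N + 2) with hb2 | hb2
  · rw [H.eq_of_le g0 h0 hb (by omega)]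
    have hfree' : PowFree u M (s₁ ++ (wpow u (g b) ++ (t₁ ++ s₂))) :=
      (hs₁.append ((powFree_wpow hu.1 _).append (ht₁.append hs₂))).mono (by omega)
    have hc2 : M + 2 ≤ g c := by
      by_contra hlt
      refine (hfree'.append ((powFree_wpow hu.1 (g c)).append ht₂)).mono
        (N := 20 * (N + 1)) (by omega) ?_
      have : s ++ (wpow u (g a) ++ t) =
        s₁ ++ (wpow u (g b) ++ (t₁ ++ s₂)) ++ (wpow u (g c) ++ t₂) := by simpa using e
      rw [← this]
      exact (wpow_prefix_of_le hge).isInfix.trans (List.infix_append' ..)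
    obtain ⟨X, Y, hX, hY, hXY, hall⟩ := hu.run_eq_run (i := g a) (hs.mono (by omega))
      (ht.mono (by omega)) hfree' (ht₂.mono (by omega)) (by omega) hc2 (by simpa using e)
    simpa using hall (h a) (h c) (le_trans (by omega) hge')
      (H.eq_add g0 h0 ha hc (hX.trans (by omega)) (hY.trans (by omega)) hXY)
  rcases Nat.lt_or_ge (g c) (2 * N + 2) with hc2 | hc2
  · rw [H.eq_of_le g0 h0 hc (by omega)]
    have hfree' : PowFree u M (t₁ ++ (s₂ ++ (wpow u (g c) ++ t₂))) :=
      (ht₁.append (hs₂.append ((powFree_wpow hu.1 _).append ht₂))).mono (by omega)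
    have hb3 : M + 2 ≤ g b := by
      by_contra hlt
      refine (hs₁.append ((powFree_wpow hu.1 (g b)).append hfree')).mono
        (N := 20 * (N + 1)) (by omega) ?_
      rw [← e]
      exact (wpow_prefix_of_le hge).isInfix.trans (List.infix_append' ..)
    obtain ⟨X, Y, hX, hY, hXY, hall⟩ := hu.run_eq_run (i := g a) (hs.mono (by omega))
      (ht.mono (by omega))
      (hs₁.mono (by omega)) hfree' (by omega) hb3 e
    exact hall (h a) (h b) (le_trans (by omega) hge')
      (H.eq_add g0 h0 ha hb (hX.trans (by omega)) (hY.trans (by omega)) hXY)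
  · -- The word `t₁ s₂` between two long runs is free of powers of `u` with exponent `2 * N`.
    obtain ⟨X, Y, hX, hY, hXY, hall⟩ := hu.run_eq_run_append_run (N := 2 * N) (i := g a)
      (hs.mono (by omega)) (ht.mono (by omega)) (hs₁.mono (by omega))
      ((ht₁.append hs₂).mono (by omega)) (ht₂.mono (by omega))
      (by omega) hb2 hc2 (by simpa using e)
    simpa using hall (h a) (h b) (h c) (le_trans (by omega) hge')
      (H.linear ha hb hc (hX.trans (by omega)) (hY.trans (by omega)) hXY)

end AtomEquiv

/-! ### The game on exponents -/

/-- The rank-`k` back-and-forth equivalence of two finite initial segments of `ℕ` with marked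
elements. The entries of `g` with index less than `n` are the marked elements: entry `0` is the
number zero, entry `1` the length of the segment, and a move changes one of the others to a number
in the segment. -/
def GameEquiv (n D : ℕ) : ℕ → (ℕ → ℕ) → (ℕ → ℕ) → Prop
  | 0, g, h => AtomEquiv n D g h
  | k + 1, g, h => AtomEquiv n D g h ∧ ∀ x, 2 ≤ x → x < n →
      (∀ i ≤ g 1, ∃ j ≤ h 1, GameEquiv n D k (Function.update g x i) (Function.update h x j)) ∧
      (∀ j ≤ h 1, ∃ i ≤ g 1, GameEquiv n D k (Function.update g x i) (Function.update h x j))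

theorem GameEquiv.atomEquiv {n D : ℕ} : ∀ {k : ℕ} {g h : ℕ → ℕ}, GameEquiv n D k g h →
    AtomEquiv n D g h
  | 0, _, _, H => H
  | _ + 1, _, _, H => H.1

theorem GameEquiv.symm {n D k : ℕ} {g h : ℕ → ℕ} (H : GameEquiv n D k g h) :
    GameEquiv n D k h g := by
  induction k generalizing g h with
  | zero => exact AtomEquiv.symm H
  | succ k ih =>
    refine ⟨H.1.symm, fun x hx hx' => ⟨fun i hi => ?_, fun j hj => ?_⟩⟩
    · obtain ⟨j, hj, hG⟩ := (H.2 x hx hx').2 i hi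
      exact ⟨j, hj, ih hG⟩
    · obtain ⟨i, hi, hG⟩ := (H.2 x hx hx').1 j hj
      exact ⟨i, hi, ih hG⟩

/-- Each of the relations `GameEquiv n D k` has finite index: it is implied by equality of an
invariant with finitely many values, the rank-`k` type. -/
theorem GameEquiv.exists_finite_invariant (n D k : ℕ) :
    ∃ (F : Type) (_ : Finite F) (τ : (ℕ → ℕ) → F), ∀ g h, τ g = τ h → GameEquiv n D k g h := by
  obtain ⟨F₀, _, τ₀, h₀⟩ : ∃ (F : Type) (_ : Finite F) (τ : (ℕ → ℕ) → F),
      ∀ g h, τ g = τ h → AtomEquiv n D g h := by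
    refine ⟨Fin n × Fin n × Fin n × Fin (D + 1) → Prop × Prop, inferInstance, fun g v =>
      (g v.1 = g v.2.1 + g v.2.2.1 + v.2.2.2, g v.1 + v.2.2.2 = g v.2.1 + g v.2.2.1), ?_⟩
    intro g h e a ha b hb c hc d hd
    have := congrFun e (⟨a, ha⟩, ⟨b, hb⟩, ⟨c, hc⟩, ⟨d, by omega⟩)
    simpa [Prod.ext_iff] using this
  induction k with
  | zero => exact ⟨F₀, inferInstance, τ₀, h₀⟩
  | succ k ih =>
    obtain ⟨F, _, τ, hτ⟩ := ih
    refine ⟨F₀ × (Fin n → Set F), inferInstance, fun g =>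
      (τ₀ g, fun x => {t | ∃ i ≤ g 1, τ (Function.update g x i) = t}), ?_⟩
    intro g h e
    refine ⟨h₀ g h (congrArg Prod.fst e), fun x _ hx => ?_⟩
    have hset := congrFun (congrArg Prod.snd e) ⟨x, hx⟩
    refine ⟨fun i hi => ?_, fun j hj => ?_⟩
    · obtain ⟨j, hj, hji⟩ := hset.subset ⟨i, hi, rfl⟩
      exact ⟨j, hj, hτ _ _ hji.symm⟩
    · obtain ⟨i, hi, hij⟩ := hset.superset ⟨j, hj, rfl⟩
      exact ⟨i, hi, hτ _ _ hij⟩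

/-! ### Factors as templates with one exponent -/

section Templates

variable {α : Type*}

/-- `IsTemplate A u B p i s t` describes the ways in which `s u ^ i t` can be a factor of
`A u ^ p B`: the outer words `s`, `t` are cut out of `A`, `u` and `B`, and the number of copies of
`u` that are left over bounds `i` in terms of `p`. In the last three cases the factor is `s`, lying
inside `A`, `B` or one copy of `u`. -/
def IsTemplate (A u B : List α) (p i : ℕ) (s t : List α) : Prop :=
  (i = p ∧ s <:+ A ∧ t <+: B) ∨
  (i + 1 ≤ p ∧ s <:+ A ∧ t <+: u) ∨
  (i + 1 ≤ p ∧ s <:+ u ∧ t <+: B) ∨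
  (i + 2 ≤ p ∧ s <:+ u ∧ t <+: u) ∨
  (i = 0 ∧ s <:+: A ∧ t = []) ∨
  (i = 0 ∧ s <:+: B ∧ t = []) ∨
  (i = 0 ∧ 1 ≤ p ∧ s <:+: u ∧ t = [])

theorem append_infix_append {a b c d m : List α} (ha : a <:+ b) (hc : c <+: d) :
    a ++ (m ++ c) <:+: b ++ (m ++ d) := by
  obtain ⟨x, rfl⟩ := ha
  obtain ⟨y, rfl⟩ := hc
  exact ⟨x, y, by simp⟩

theorem IsTemplate.infix {A u B s t : List α} {p i : ℕ} (h : IsTemplate A u B p i s t) :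
    s ++ (wpow u i ++ t) <:+: A ++ (wpow u p ++ B) := by
  rcases h with ⟨rfl, hs, ht⟩ | ⟨hi, hs, ht⟩ | ⟨hi, hs, ht⟩ | ⟨hi, hs, ht⟩ | ⟨rfl, hs, rfl⟩ |
    ⟨rfl, hs, rfl⟩ | ⟨rfl, hp, hs, rfl⟩
  · exact append_infix_append hs ht
  · obtain ⟨k, rfl⟩ : ∃ k, p = i + (1 + k) := ⟨p - i - 1, by omega⟩
    exact (append_infix_append hs ht).trans ⟨[], wpow u k ++ B, by simp [wpow_add]⟩
  · obtain ⟨k, rfl⟩ : ∃ k, p = k + (1 + i) := ⟨p - i - 1, by omega⟩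
    exact (append_infix_append hs ht).trans ⟨A ++ wpow u k, [], by simp [wpow_add]⟩
  · obtain ⟨k, rfl⟩ : ∃ k, p = 1 + (i + (1 + k)) := ⟨p - i - 2, by omega⟩
    exact (append_infix_append hs ht).trans ⟨A, wpow u k ++ B, by simp [wpow_add]⟩
  · simpa using hs.trans List.infix_append_left
  · simpa using hs.trans (List.infix_append_right.trans List.infix_append_right)
  · obtain ⟨k, rfl⟩ : ∃ k, p = 1 + k := ⟨p - 1, by omega⟩
    simpa using hs.trans ⟨A, wpow u k ++ B, by simp [wpow_add]⟩

/-- Every factor of `A u ^ p B` arises from a template. -/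
theorem exists_isTemplate {A u B x : List α} (hu : u ≠ []) {p : ℕ}
    (h : x <:+: A ++ (wpow u p ++ B)) :
    ∃ i s t, i ≤ p ∧ x = s ++ (wpow u i ++ t) ∧ IsTemplate A u B p i s t := by
  rcases List.infix_append_iff.1 h with h | h | ⟨s, y, rfl, hs, h⟩
  · exact ⟨0, x, [], by omega, by simp, by simp [IsTemplate, h]⟩
  · rcases List.infix_append_iff.1 h with h | h | ⟨y, t, rfl, h, ht⟩
    · obtain ⟨z, hxz, hz⟩ := List.infix_iff_suffix_prefix.1 h
      obtain ⟨a, r, rfl, hr, ha⟩ := prefix_wpow hu hz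
      rcases suffix_append_cases hxz with hx | ⟨y, rfl, hy⟩
      · refine ⟨0, x, [], by omega, by simp, ?_⟩
        rcases ha with ha | ⟨-, rfl⟩
        · have := hx.isInfix.trans hr.isInfix
          simp only [IsTemplate, this]
          have : 1 ≤ p := by omega
          simp [this]
        · obtain rfl := List.suffix_nil.1 hx
          simp [IsTemplate]
      · obtain ⟨b, s, rfl, hs, hb⟩ := suffix_wpow hu hy
        refine ⟨b, s, r, by omega, by simp, ?_⟩
        rcases ha with ⟨ha, -⟩ | ⟨rfl, rfl⟩ <;> rcases hb with ⟨hb, -⟩ | ⟨rfl, rfl⟩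
        · exact .inr (.inr (.inr (.inl ⟨by omega, hs, hr⟩)))
        · exact .inr (.inl ⟨ha, by simp, hr⟩)
        · exact .inr (.inr (.inl ⟨hb, hs, by simp⟩))
        · exact .inl ⟨rfl, by simp, by simp⟩
    · exact ⟨0, x, [], by omega, by simp, by simp [IsTemplate, h]⟩
    · obtain ⟨a, s, rfl, hs, ha⟩ := suffix_wpow hu h
      refine ⟨a, s, t, by omega, by simp, ?_⟩
      rcases ha with ⟨ha, -⟩ | ⟨rfl, rfl⟩
      · exact .inr (.inr (.inl ⟨ha, hs, ht⟩))
      · exact .inl ⟨rfl, by simp, ht⟩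
  · rcases prefix_append_cases h with h | ⟨t, rfl, ht⟩
    · obtain ⟨a, t, rfl, ht, ha⟩ := prefix_wpow hu h
      refine ⟨a, s, t, by omega, rfl, ?_⟩
      rcases ha with ⟨ha, -⟩ | ⟨rfl, rfl⟩
      · exact .inr (.inl ⟨ha, hs, ht⟩)
      · exact .inl ⟨rfl, hs, by simp⟩
    · exact ⟨p, s, t, le_rfl, rfl, .inl ⟨rfl, hs, ht⟩⟩

theorem IsTemplate.powFree {A u B s t : List α} {p i N : ℕ} (h : IsTemplate A u B p i s t)
    (hA : PowFree u N A) (hu : PowFree u N u) (hB : PowFree u N B) :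
    PowFree u N s ∧ PowFree u N t := by
  have hnil : PowFree u N [] := hu.of_infix List.nil_infix
  rcases h with ⟨-, hs, ht⟩ | ⟨-, hs, ht⟩ | ⟨-, hs, ht⟩ | ⟨-, hs, ht⟩ | ⟨-, hs, rfl⟩ |
    ⟨-, hs, rfl⟩ | ⟨-, -, hs, rfl⟩
  · exact ⟨hA.of_infix hs.isInfix, hB.of_infix ht.isInfix⟩
  · exact ⟨hA.of_infix hs.isInfix, hu.of_infix ht.isInfix⟩
  · exact ⟨hu.of_infix hs.isInfix, hB.of_infix ht.isInfix⟩
  · exact ⟨hu.of_infix hs.isInfix, hu.of_infix ht.isInfix⟩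
  · exact ⟨hA.of_infix hs, hnil⟩
  · exact ⟨hB.of_infix hs, hnil⟩
  · exact ⟨hu.of_infix hs, hnil⟩

/-- Replacing `p` and `i` by numbers in the same bounded linear relations keeps a template valid, as
only `i = 0`, `i = p` and the bounds `i + d ≤ p` with `d ≤ 2` matter. -/
theorem IsTemplate.of_atomEquiv {A u B s t : List α} {n D : ℕ} {g h : ℕ → ℕ}
    (H : AtomEquiv n D g h) (g0 : g 0 = 0) (h0 : h 0 = 0) (hD : 2 ≤ D) {a : ℕ} (ha : a < n)
    (hn : 1 < n) (hh : h a ≤ h 1) (hT : IsTemplate A u B (g 1) (g a) s t) :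
    IsTemplate A u B (h 1) (h a) s t := by
  have hle : ∀ d ≤ 2, g a + d ≤ g 1 → h a + d ≤ h 1 := by
    intro d hd hgd
    by_contra hlt
    have := H.symm.eq_add h0 g0 (a := 1) (b := a) (X := 0) (Y := h 1 - h a) hn ha (by omega)
      (by omega) (by omega)
    omega
  have hz : g a = 0 → h a = 0 := fun hz => by rw [H.eq_of_le g0 h0 ha (by omega), hz]
  have hp : g a = g 1 → h a = h 1 := fun he => by
    simpa using H.eq_add g0 h0 (X := 0) (Y := 0) ha hn (by omega) (by omega) (by simpa using he)
  have h1 : 1 ≤ g 1 → 1 ≤ h 1 := fun h1 => H.le_of_le g0 h0 hn (by omega) h1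
  rcases hT with ⟨e, hs, ht⟩ | ⟨e, hs, ht⟩ | ⟨e, hs, ht⟩ | ⟨e, hs, ht⟩ | ⟨e, hs, ht⟩ |
    ⟨e, hs, ht⟩ | ⟨e, e', hs, ht⟩
  · exact .inl ⟨hp e, hs, ht⟩
  · exact .inr (.inl ⟨hle 1 (by omega) e, hs, ht⟩)
  · exact .inr (.inr (.inl ⟨hle 1 (by omega) e, hs, ht⟩))
  · exact .inr (.inr (.inr (.inl ⟨hle 2 (by omega) e, hs, ht⟩)))
  · exact .inr (.inr (.inr (.inr (.inl ⟨hz e, hs, ht⟩))))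
  · exact .inr (.inr (.inr (.inr (.inr (.inl ⟨hz e, hs, ht⟩)))))
  · exact .inr (.inr (.inr (.inr (.inr (.inr ⟨hz e, h1 e', hs, ht⟩)))))

end Templates

/-! ### Transfer of formulas -/

section Transfer

variable {α : Type*}

/-- The quantifier rank of a formula. -/
def Formula.rank : Formula α → ℕ
  | .eqConcat _ _ _ => 0
  | .and φ ψ => max φ.rank ψ.rank
  | .or φ ψ => max φ.rank ψ.rank
  | .not φ => φ.rank
  | .all _ φ => φ.rank + 1
  | .ex _ φ => φ.rank + 1

/-- A strict upper bound on the variable of a term, if there is one. -/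
def Term.varBound : Term α → ℕ
  | .var x => x + 1
  | _ => 0

/-- A strict upper bound on the variables of a formula, free or bound. -/
def Formula.varBound : Formula α → ℕ
  | .eqConcat x y z => max x.varBound (max y.varBound z.varBound)
  | .and φ ψ => max φ.varBound ψ.varBound
  | .or φ ψ => max φ.varBound ψ.varBound
  | .not φ => φ.varBound
  | .all x φ => max (x + 1) φ.varBound
  | .ex x φ => max (x + 1) φ.varBound

/-- The assignments `σ` and `τ` arise from common outer words `S x`, `T x`, free of high powers
of `u`, by inserting powers of `u`; the exponent for the variable `x` is entry `x + 2` of `g` and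
of `h`, respectively. -/
structure Similar (u : List α) (N : ℕ) (g h : ℕ → ℕ) (S T : ℕ → List α) {w w' : List α}
    (σ : ℕ → Facs w) (τ : ℕ → Facs w') : Prop where
  left : ∀ x, (σ x).1 = S x ++ (wpow u (g (x + 2)) ++ T x)
  right : ∀ x, (τ x).1 = S x ++ (wpow u (h (x + 2)) ++ T x)
  free : ∀ x, PowFree u N (S x) ∧ PowFree u N (T x)

namespace Similar

variable {u : List α} {N : ℕ} {g h : ℕ → ℕ} {S T : ℕ → List α} {w w' : List α}
  {σ : ℕ → Facs w} {τ : ℕ → Facs w'}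

theorem symm (H : Similar u N g h S T σ τ) : Similar u N h g S T τ σ :=
  ⟨H.right, H.left, H.free⟩

theorem update (H : Similar u N g h S T σ τ) (x : ℕ) {y : Facs w} {z : Facs w'} {i j : ℕ}
    {s t : List α} (hs : PowFree u N s) (ht : PowFree u N t)
    (hy : y.1 = s ++ (wpow u i ++ t)) (hz : z.1 = s ++ (wpow u j ++ t)) :
    Similar u N (Function.update g (x + 2) i) (Function.update h (x + 2) j)
      (Function.update S x s) (Function.update T x t)
      (Function.update σ x y) (Function.update τ x z) := by
  constructor <;> intro x' <;> rcases eq_or_ne x' x with rfl | hx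
  · simpa using hy
  · simpa [hx] using H.left x'
  · simpa using hz
  · simpa [hx] using H.right x'
  · simpa using ⟨hs, ht⟩
  · simpa [hx] using H.free x'

/-- Under similar assignments, a term denotes the null value in both structures, or values in both
that arise from common outer words. -/
theorem eval_term (H : Similar u N g h S T σ τ) (g0 : g 0 = 0) (h0 : h 0 = 0) (hu : u ≠ [])
    (hN : 2 ≤ N) (hw : ∀ a, a ∈ w ↔ a ∈ w') {n : ℕ} (t : Term α) (ht : t.varBound ≤ n) :
    t.eval σ = none ∧ t.eval τ = none ∨
    ∃ a < n + 2, ∃ s r, PowFree u N s ∧ PowFree u N r ∧ ∃ y z, t.eval σ = some y ∧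
      t.eval τ = some z ∧ y.1 = s ++ (wpow u (g a) ++ r) ∧ z.1 = s ++ (wpow u (h a) ++ r) := by
  have hu' := List.length_pos_iff.2 hu
  have hfree : ∀ s : List α, s.length ≤ 1 → PowFree u N s :=
    fun s hs => powFree_of_length_lt (by nlinarith)
  cases t with
  | var x =>
    simp only [Term.varBound] at ht
    exact .inr ⟨x + 2, by omega, S x, T x, (H.free x).1, (H.free x).2, σ x, τ x, rfl, rfl,
      H.left x, H.right x⟩
  | letter a =>
    by_cases ha : a ∈ w
    · exact .inr ⟨0, by omega, [a], [], hfree _ (by simp), hfree _ (by simp), _, _,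
        dif_pos ha, dif_pos ((hw a).1 ha), by simp [g0], by simp [h0]⟩
    · exact .inl ⟨dif_neg ha, dif_neg (fun h => ha ((hw a).2 h))⟩
  | eps =>
    exact .inr ⟨0, by omega, [], [], hfree _ (by simp), hfree _ (by simp), _, _, rfl, rfl,
      by simp [g0], by simp [h0]⟩

theorem concat_of_concat (H : Similar u N g h S T σ τ) {n D : ℕ} (hE : AtomEquiv (n + 2) D g h)
    (g0 : g 0 = 0) (h0 : h 0 = 0) (hu : Primitive u) (hN : 2 ≤ N) (hD : 50 * (N + 1) ≤ D)
    (hw : ∀ a, a ∈ w ↔ a ∈ w') {x y z : Term α} (hx : x.varBound ≤ n) (hy : y.varBound ≤ n)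
    (hz : z.varBound ≤ n) (hc : Concat (x.eval σ) (y.eval σ) (z.eval σ)) :
    Concat (x.eval τ) (y.eval τ) (z.eval τ) := by
  obtain ⟨x₁, y₁, z₁, ex, ey, ez, e⟩ := hc
  rcases H.eval_term g0 h0 hu.1 hN hw x hx with ⟨h1, -⟩ |
    ⟨a, ha, s, t, hs, ht, x₂, x₃, ex₂, ex₃, vx, vx'⟩
  · simp [ex] at h1
  rcases H.eval_term g0 h0 hu.1 hN hw y hy with ⟨h1, -⟩ |
    ⟨b, hb, s₁, t₁, hs₁, ht₁, y₂, y₃, ey₂, ey₃, vy, vy'⟩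
  · simp [ey] at h1
  rcases H.eval_term g0 h0 hu.1 hN hw z hz with ⟨h1, -⟩ |
    ⟨c, hc, s₂, t₂, hs₂, ht₂, z₂, z₃, ez₂, ez₃, vz, vz'⟩
  · simp [ez] at h1
  obtain rfl : x₁ = x₂ := Option.some.inj (ex.symm.trans ex₂)
  obtain rfl : y₁ = y₂ := Option.some.inj (ey.symm.trans ey₂)
  obtain rfl : z₁ = z₂ := Option.some.inj (ez.symm.trans ez₂)
  refine ⟨x₃, y₃, z₃, ex₃, ey₃, ez₃, ?_⟩
  rw [vx', vy', vz']
  simpa using hE.concat_run g0 h0 hu hD ha hb hc hs ht hs₁ ht₁ hs₂ ht₂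
    (by simpa [vx, vy, vz] using e)

/-- A move on factors is answered by moving the exponent in the game on exponents and keeping the
outer words. -/
theorem exists_update {A B : List α} {p q : ℕ}
    {σ : ℕ → Facs (A ++ (wpow u p ++ B))} {τ : ℕ → Facs (A ++ (wpow u q ++ B))}
    (H : Similar u N g h S T σ τ) {n D k : ℕ} (hE : GameEquiv (n + 2) D (k + 1) g h)
    (g0 : g 0 = 0) (h0 : h 0 = 0) (g1 : g 1 = p) (h1 : h 1 = q) (hu : u ≠ []) (hD : 2 ≤ D)
    (hA : PowFree u N A) (huN : PowFree u N u) (hB : PowFree u N B) {x : ℕ} (hx : x < n)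
    (y : Facs (A ++ (wpow u p ++ B))) :
    ∃ z i j s t, GameEquiv (n + 2) D k (Function.update g (x + 2) i)
        (Function.update h (x + 2) j) ∧
      Similar u N (Function.update g (x + 2) i) (Function.update h (x + 2) j)
        (Function.update S x s) (Function.update T x t)
        (Function.update σ x y) (Function.update τ x z) := by
  subst g1 h1
  obtain ⟨i, s, t, hi, hy, hT⟩ := exists_isTemplate hu y.2
  obtain ⟨j, hj, hG⟩ := (hE.2 (x + 2) (by omega) (by omega)).1 i hi
  have hT' : IsTemplate A u B (h 1) j s t := by
    simpa using IsTemplate.of_atomEquiv (A := A) (u := u) (B := B) (s := s) (t := t) hG.atomEquiv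
      (by simpa) (by simpa) hD
      (a := x + 2) (by omega) (by omega) (by simpa) (by simpa)
  have hf := hT.powFree hA huN hB
  exact ⟨⟨_, hT'.infix⟩, i, j, s, t, hG, H.update x hf.1 hf.2 hy rfl⟩

/-- Similar assignments whose exponents are equivalent in the game satisfy the same formulas of the
corresponding rank; the bound `D` on the constants depends on `N` only, not on the formula. -/
theorem sat_iff {A B : List α} {p q : ℕ} {n D k : ℕ} {φ : Formula α} (hn : φ.varBound ≤ n)
    (hk : φ.rank ≤ k) {σ : ℕ → Facs (A ++ (wpow u p ++ B))}
    {τ : ℕ → Facs (A ++ (wpow u q ++ B))} (H : Similar u N g h S T σ τ)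
    (hE : GameEquiv (n + 2) D k g h)
    (g0 : g 0 = 0) (h0 : h 0 = 0) (g1 : g 1 = p) (h1 : h 1 = q)
    (hu : Primitive u) (hN : 2 ≤ N) (hD : 50 * (N + 1) ≤ D)
    (hA : PowFree u N A) (huN : PowFree u N u) (hB : PowFree u N B) :
    φ.Sat σ ↔ φ.Sat τ := by
  induction φ generalizing k g h S T σ τ with
  | eqConcat x y z =>
    simp only [Formula.varBound, max_le_iff] at hn
    have hpq : p = 0 ↔ q = 0 := by
      have := hE.atomEquiv.eq_of_le g0 h0 (a := 1) (by omega)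
      have := hE.symm.atomEquiv.eq_of_le h0 g0 (a := 1) (by omega)
      omega
    have hmem : ∀ (p : ℕ) (a : α), a ∈ wpow u p ↔ p ≠ 0 ∧ a ∈ u := by simp [wpow]
    have hw : ∀ a, a ∈ A ++ (wpow u p ++ B) ↔ a ∈ A ++ (wpow u q ++ B) := by
      simp [hmem, hpq]
    exact ⟨H.concat_of_concat hE.atomEquiv g0 h0 hu hN hD hw hn.1 hn.2.1 hn.2.2,
      H.symm.concat_of_concat hE.symm.atomEquiv h0 g0 hu hN hD (fun a => (hw a).symm)
        hn.1 hn.2.1 hn.2.2⟩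
  | and φ ψ ihφ ihψ =>
    simp only [Formula.varBound, Formula.rank, max_le_iff] at hn hk
    exact and_congr (ihφ hn.1 hk.1 H hE g0 h0 g1 h1) (ihψ hn.2 hk.2 H hE g0 h0 g1 h1)
  | or φ ψ ihφ ihψ =>
    simp only [Formula.varBound, Formula.rank, max_le_iff] at hn hk
    exact or_congr (ihφ hn.1 hk.1 H hE g0 h0 g1 h1) (ihψ hn.2 hk.2 H hE g0 h0 g1 h1)
  | not φ ih => exact not_congr (ih hn hk H hE g0 h0 g1 h1)
  | all x φ ih =>
    simp only [Formula.varBound, Formula.rank, max_le_iff] at hn hk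
    obtain ⟨k, rfl⟩ := Nat.exists_eq_add_of_le' (Nat.one_le_of_lt hk)
    constructor
    · intro hφ z
      obtain ⟨y, i, j, s, t, hG, hS⟩ := H.symm.exists_update hE.symm h0 g0 h1 g1 hu.1 (by omega)
        hA huN hB hn.1 z
      exact (ih hn.2 (by omega) hS.symm hG.symm (by simpa) (by simpa) (by simpa) (by simpa)).1
        (hφ y)
    · intro hφ y
      obtain ⟨z, i, j, s, t, hG, hS⟩ := H.exists_update hE g0 h0 g1 h1 hu.1 (by omega)
        hA huN hB hn.1 y
      exact (ih hn.2 (by omega) hS hG (by simpa) (by simpa) (by simpa) (by simpa)).2 (hφ z)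
  | ex x φ ih =>
    simp only [Formula.varBound, Formula.rank, max_le_iff] at hn hk
    obtain ⟨k, rfl⟩ := Nat.exists_eq_add_of_le' (Nat.one_le_of_lt hk)
    constructor
    · rintro ⟨y, hφ⟩
      obtain ⟨z, i, j, s, t, hG, hS⟩ := H.exists_update hE g0 h0 g1 h1 hu.1 (by omega)
        hA huN hB hn.1 y
      exact ⟨z, (ih hn.2 (by omega) hS hG (by simpa) (by simpa) (by simpa) (by simpa)).1 hφ⟩
    · rintro ⟨z, hφ⟩
      obtain ⟨y, i, j, s, t, hG, hS⟩ := H.symm.exists_update hE.symm h0 g0 h1 g1 hu.1 (by omega)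
        hA huN hB hn.1 z
      exact ⟨y, (ih hn.2 (by omega) hS.symm hG.symm (by simpa) (by simpa) (by simpa)
        (by simpa)).2 hφ⟩

end Similar

/-- A sentence does not distinguish all powers of a primitive word `u`: two different exponents
can be exchanged between any outer words without high powers of `u`. -/
theorem Formula.IsSentence.exists_exchange {φ : Formula α} (hφ : φ.IsSentence) {u : List α}
    (hu : Primitive u) (N : ℕ) :
    ∃ p q, p ≠ q ∧ ∀ A B, PowFree u N A → PowFree u N B →
      A ++ (wpow u p ++ B) ∈ φ.lang → A ++ (wpow u q ++ B) ∈ φ.lang := by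
  obtain ⟨F, _, τ, hτ⟩ := GameEquiv.exists_finite_invariant (φ.varBound + 2) (50 * (N + 2 + 1))
    φ.rank
  -- The position in which only the length of the segment is marked.
  let g : ℕ → ℕ → ℕ := fun p => Function.update (fun _ => 0) 1 p
  obtain ⟨p, q, hpq, he⟩ := Finite.exists_ne_map_eq_of_infinite (fun p => τ (g p))
  refine ⟨p, q, hpq, fun A B hA hB hp ρ => ?_⟩
  -- Letters, and `u` itself, have to be free of powers of `u` as well; hence `N + 2`.
  have huN : PowFree u (N + 2) u :=
    powFree_of_length_lt (by have := List.length_pos_iff.2 hu.1; nlinarith)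
  have hS : Similar u (N + 2) (g p) (g q) (fun _ => []) (fun _ => [])
      (fun _ => (⟨[], List.nil_infix⟩ : Facs (A ++ (wpow u p ++ B))))
      (fun _ => (⟨[], List.nil_infix⟩ : Facs (A ++ (wpow u q ++ B)))) :=
    ⟨fun x => by simp [g], fun x => by simp [g],
      fun _ => ⟨huN.of_infix List.nil_infix, huN.of_infix List.nil_infix⟩⟩
  have := (hS.sat_iff le_rfl le_rfl (hτ _ _ he) (by simp [g]) (by simp [g]) (by simp [g])
    (by simp [g]) hu (by omega) le_rfl (hA.mono (by omega)) huN (hB.mono (by omega))).1 (hp _)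
  refine (φ.sat_congr ?_).1 this
  rw [hφ]
  simp

end Transfer

/-! ### Uniqueness of the exponents -/

/-- For co-primitive `u`, `v`, the word `u ^ a x v ^ b` determines the exponents `a` and `b`. -/
theorem CoPrimitive.wpow_append_inj {α : Type*} {u v : List α} (h : CoPrimitive u v)
    (x : List α) {a b a' b' : ℕ}
    (e : wpow u a ++ (x ++ wpow v b) = wpow u a' ++ (x ++ wpow v b')) : a = a' ∧ b = b' := by
  wlog hle : a ≤ a' generalizing a b a' b'
  · exact (this e.symm (by omega)).imp Eq.symm Eq.symm
  have hu := List.length_pos_iff.2 h.1.1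
  have hv := List.length_pos_iff.2 h.2.1.1
  obtain ⟨c, rfl⟩ := Nat.exists_eq_add_of_le hle
  rw [wpow_add, List.append_assoc, List.append_cancel_left_eq] at e
  have hlen := congrArg List.length e
  simp only [List.length_append, length_wpow] at hlen
  have hb : b' ≤ b := by
    by_contra hlt
    have := Nat.mul_lt_mul_of_pos_right (Nat.lt_of_not_le hlt) hv
    omega
  obtain ⟨d, rfl⟩ := Nat.exists_eq_add_of_le' hb
  rw [wpow_add] at e
  have e' : x ++ wpow v d = wpow u c ++ x :=
    List.append_cancel_right (bs := wpow v b') (by simpa using e)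
  -- Iterating the equation `x v ^ d = u ^ c x` puts arbitrarily high powers of `u` into words
  -- `x v ^ m`.
  have key : ∀ n, x ++ wpow v (d * n) = wpow u (c * n) ++ x := by
    intro n
    induction n with
    | zero => simp
    | succ n ih =>
      rw [Nat.mul_succ, Nat.mul_succ, wpow_add, ← List.append_assoc, ih, List.append_assoc, e',
        wpow_add, List.append_assoc]
  obtain ⟨N, hN⟩ := h.exists_powFree x []
  rcases Nat.eq_zero_or_pos c with rfl | hc
  · have : d * v.length = 0 := by
      rw [Nat.add_mul] at hlen
      omega
    rcases Nat.mul_eq_zero.1 this with rfl | h0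
    · simp
    · omega
  · refine absurd ?_ (hN (d * N))
    rw [List.append_nil, key]
    exact (wpow_prefix_of_le (Nat.le_mul_of_pos_left N hc)).isInfix.trans List.infix_append_left

end FC

theorem mainTheorem3 {α : Type*} [Finite α] (w₁ w₂ w₃ u v : List α) (huv : FC.CoPrimitive u v)
    (f : ℕ → ℕ) (hf : Function.Injective f) :
    ¬ FC.Definable
      {w : List α | ∃ p : ℕ, w = w₁ ++ FC.wpow u p ++ w₂ ++ FC.wpow v (f p) ++ w₃} := by
  rintro ⟨φ, hφ, hL⟩
  obtain ⟨N, hN⟩ := huv.exists_powFree w₂ w₃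
  obtain ⟨p, q, hpq, hex⟩ := hφ.exists_exchange huv.1 (N + (w₁.length + 1))
  have hq := hex w₁ (w₂ ++ FC.wpow v (f p) ++ w₃)
    ((FC.powFree_length_succ huv.1.1 w₁).mono (by omega)) ((hN (f p)).mono (by omega))
    (by rw [hL]; exact ⟨p, by simp⟩)
  rw [hL] at hq
  obtain ⟨r, hr⟩ := hq
  have e : FC.wpow u q ++ (w₂ ++ FC.wpow v (f p)) = FC.wpow u r ++ (w₂ ++ FC.wpow v (f r)) :=
    List.append_cancel_right (bs := w₃) (List.append_cancel_left (as := w₁) (by simpa using hr))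
  obtain ⟨rfl, hfr⟩ := huv.wpow_append_inj w₂ e
  exact hpq (hf hfr)
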